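/- Let $G$ be a finite connected simple graph, with at least one edge, embedded in the plane so that every face (the outer face included) is a triangle, i.e. has a boundary walk of length three. The embedding is given combinatorially: by a cyclic order of the edges around each vertex whose facial walks, obtained by face tracing, satisfy $|V(G)|-|E(G)|+|F(G)|=2$. The expanded dual graph $G^*$ of $G$ has one vertex for each pair (edge $e$ of $G$, side of $e$). For each face of $G$, the three vertices given by the sides of edges lying along that face are pairwise adjacent (a "Fisher city", a triangle); and for each edge $e$ of $G$ the two vertices given by the two sides of $e$ are adjacent. The edges of the latter kind are called intercity edges, their set is $E^*_I$, and the intercity edge that joins the two sides of $e$ is said to cross $e$. Let $\mathrm{PM}(G^*)$ be the set of perfect matchings of $G^*$. For a spin configuration $X=(x_v)_{v\in V(G)}\in\{\pm1\}^{V(G)}$ let $I(X)\subseteq E^*_I$ be the set of intercity edges that cross an edge $\{v,w\}$ of $G$ with $x_v=x_w$. Then for every $X\in\{\pm1\}^{V(G)}$ there is exactly one perfect matching $M(X)\in\mathrm{PM}(G^*)$ with $M(X)\cap E^*_I=I(X)$, that is, $I(X)$ can be uniquely completed to a perfect matching of $G^*$ by edges of Fisher cities. Moreover, for every fixed vertex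 $v_1$ of $G$, the map $M$ restricts to a bijection from $\mathcal C_+=\{X\in\{\pm1\}^{V(G)} : x_{v_1}=+1\}$ onto $\mathrm{PM}(G^*)$. -/

import Mathlib

/-- A rotation system on a simple graph `G`, i.e. the combinatorial form of a cellular embedding of
`G` in an oriented surface: for every vertex `v`, a cyclic order on the darts (oriented edges)
leaving `v`. The orders are recorded by one permutation `rot` of the darts whose cycles are exactly
the sets of darts with a common source; `rot d` is the dart that follows `d` around its source. -/
structure RotationSystem {V : Type*} (G : SimpleGraph V) where
  rot : Equiv.Perm G.Dart
  rot_fst : ∀ d : G.Dart, (rot d).fst = d.fst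
  rot_sameCycle : ∀ d d' : G.Dart, d.fst = d'.fst → rot.SameCycle d d'

namespace RotationSystem

variable {V : Type*} {G : SimpleGraph V} (R : RotationSystem G)

/-- Face tracing: arrive at `d.snd` along `d`, turn to the next dart around `d.snd`. -/
def facePerm : Equiv.Perm G.Dart :=
  (SimpleGraph.Dart.symm_involutive (G := G)).toPerm.trans R.rot

/-- The faces of the embedding: cycles of face tracing. -/
def Face : Type _ :=
  Quotient (Equiv.Perm.SameCycle.setoid R.facePerm)

/-- The face on whose boundary walk the dart `d` lies. The darts `d` and `d.symm` represent the
two sides of an edge, and `R.face d`, `R.face d.symm` are the faces on these two sides. -/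
def face (d : G.Dart) : R.Face :=
  Quotient.mk (Equiv.Perm.SameCycle.setoid R.facePerm) d

/-- The embedded graph (with at least one edge) is connected, and the surface that carries it is
the sphere: `|V| - |E| + |F| = 2`. Equivalently, `R` is an embedding of a connected graph in the
plane, the outer face being one of the faces. -/
def IsPlane : Prop :=
  G.Connected ∧ Nat.card V + Nat.card R.Face = Nat.card G.edgeSet + 2

/-- Every face (the outer one included) is a triangle, i.e. its boundary walk has length three. -/
def IsTriangulated : Prop :=
  ∀ f : R.Face, {d : G.Dart | R.face d = f}.ncard = 3

/-- The expanded dual graph `G*`. Its vertices are the darts of `G` (pairs of an edge and a side of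
it), grouped by the face they lie on. Distinct vertices of one face are joined (Fisher city,
a triangle `K₃` when `G` is triangulated), and, for every edge of `G`, the vertices `d` and `d.symm`
that belong to its two sides are joined (intercity edge). -/
def expandedDual : SimpleGraph G.Dart where
  Adj d d' := d ≠ d' ∧ (R.face d = R.face d' ∨ d' = d.symm)
  symm := ⟨by
    rintro d d' ⟨hne, h | h⟩
    · exact ⟨hne.symm, Or.inl h.symm⟩
    · exact ⟨hne.symm, Or.inr (by rw [h, SimpleGraph.Dart.symm_symm])⟩⟩
  loopless := ⟨fun _ h => h.1 rfl⟩

/-- The set of intercity edges of `G*`. The edge `s(d, d.symm)` crosses the edge `d.edge` of `G`. -/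
def intercityEdges (_R : RotationSystem G) : Set (Sym2 G.Dart) :=
  {e | ∃ d : G.Dart, e = s(d, d.symm)}

/-- `I(X)`: the intercity edges that cross an edge `{v, w}` of `G` with `X v = X w`. -/
def saturated (_R : RotationSystem G) (X : V → ℤˣ) : Set (Sym2 G.Dart) :=
  {e | ∃ d : G.Dart, e = s(d, d.symm) ∧ X d.fst = X d.snd}

/-- `S` is a perfect matching of `G*` completing `I(X)` by Fisher city edges, i.e. by edges of `G*`
that are not intercity edges. -/
def Completes (X : V → ℤˣ) (S : R.expandedDual.Subgraph) : Prop :=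
  S.IsPerfectMatching ∧ S.edgeSet ∩ R.intercityEdges = R.saturated X

/-- `M(X)`: the perfect matching of `G*` completing `I(X)`. -/
noncomputable def matching (X : V → ℤˣ) : R.expandedDual.Subgraph :=
  Classical.epsilon (R.Completes X)

end RotationSystem

/-! Call a set of intercity edges odd if it meets every Fisher city in one or three vertices. Zero
or two vertices of each triangle then remain, so an odd set has exactly one completion by city
edges; conversely a perfect matching meets each city oddly, since its city edges cover an even
number of the three vertices. Hence perfect matchings correspond to odd sets
(`isPerfectMatching_matchingOf`, `perfectMatching_ext`).

Around a triangle a spin configuration changes sign an even number of times, so `I(X)` is odd.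
Conversely, the complement of an odd set is a mod 2 edge function with zero sum along every face. On
the sphere it is a coboundary (`exists_coboundary_eq`), that is, the set of edges where some spin
configuration disagrees. Connectedness makes this configuration unique up to a global flip, which
fixing the spin at `v₁` removes. -/

namespace RotationSystem

/-! ### Mod 2 cohomology of the sphere. -/

section Cohomology

variable {V : Type*} {G : SimpleGraph V} (R : RotationSystem G)

theorem facePerm_apply (d : G.Dart) : R.facePerm d = R.rot d.symm := rfl

theorem facePerm_fst (d : G.Dart) : (R.facePerm d).fst = d.snd := by
  rw [facePerm_apply, R.rot_fst]; rfl

theorem face_eq_face_iff {d d' : G.Dart} :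
    R.face d = R.face d' ↔ R.facePerm.SameCycle d d' :=
  Quotient.eq (r := Equiv.Perm.SameCycle.setoid R.facePerm)

theorem face_facePerm (d : G.Dart) : R.face (R.facePerm d) = R.face d :=
  R.face_eq_face_iff.2 (Equiv.Perm.sameCycle_apply_left.2 (Equiv.Perm.SameCycle.refl _ _))

theorem face_surjective : Function.Surjective R.face := Quotient.mk_surjective

instance finite_dart [Finite V] : Finite G.Dart :=
  Finite.of_injective _ (SimpleGraph.Dart.toProd_injective (G := G))

instance finite_face [Finite V] : Finite R.Face := Finite.of_surjective _ R.face_surjective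

/-- On a connected graph, a function of the faces that agrees on the two sides of every edge is
constant: the dual graph is connected. -/
theorem face_function_const {α : Type*} (hG : G.Connected) (g : R.Face → α)
    (hg : ∀ d : G.Dart, g (R.face d) = g (R.face d.symm)) (f f' : R.Face) : g f = g f' := by
  -- The next dart around the source lies on the face across the edge of `d`, because `rot d` is the
  -- face successor of `d.symm`.
  have hrot : ∀ d, g (R.face (R.rot d)) = g (R.face d) := by
    intro d
    have h := R.face_facePerm d.symm
    rw [facePerm_apply, SimpleGraph.Dart.symm_symm] at h
    rw [h, ← hg]
  have hzpow : ∀ (d : G.Dart) (i : ℤ), g (R.face ((R.rot ^ i) d)) = g (R.face d) := by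
    intro d i
    induction i using Int.induction_on with
    | zero => simp
    | succ n ih => rw [add_comm, zpow_add, zpow_one, Equiv.Perm.mul_apply, hrot, ih]
    | pred n ih =>
      rw [← ih, ← hrot ((R.rot ^ (-(n : ℤ) - 1)) d), ← Equiv.Perm.mul_apply, ← zpow_one_add]
      congr 4
      ring
  have hfst : ∀ d d' : G.Dart, d.fst = d'.fst → g (R.face d) = g (R.face d') := by
    intro d d' h
    obtain ⟨i, rfl⟩ := R.rot_sameCycle d d' h
    exact (hzpow d i).symm
  have hwalk : ∀ {v w : V} (_ : G.Walk v w) (d d' : G.Dart), d.fst = v → d'.fst = w →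
      g (R.face d) = g (R.face d') := by
    intro v w p
    induction p with
    | nil => exact fun d d' h h' => hfst d d' (h.trans h'.symm)
    | @cons a b _ hab _ ih =>
      intro d d' h h'
      rw [hfst d ⟨(a, b), hab⟩ h, hg]
      exact ih _ _ rfl h'
  obtain ⟨d, rfl⟩ := R.face_surjective f
  obtain ⟨d', rfl⟩ := R.face_surjective f'
  exact hwalk (hG.preconnected d.fst d'.fst).some d d' rfl rfl

/-- The coboundary map from vertex functions to edge functions mod 2. -/
def coboundary (G : SimpleGraph V) : (V → ZMod 2) →ₗ[ZMod 2] (G.edgeSet → ZMod 2) where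
  toFun x e := Sym2.lift ⟨fun a b => x a + x b, fun _ _ => add_comm _ _⟩ e.1
  map_add' x y := by
    ext ⟨e, he⟩
    induction e using Sym2.ind
    simp only [Sym2.lift_mk, Pi.add_apply]
    ring
  map_smul' c x := by
    ext ⟨e, he⟩
    induction e using Sym2.ind
    simp only [Sym2.lift_mk, Pi.smul_apply, smul_eq_mul, RingHom.id_apply]
    ring

/-- The edge of a dart as an element of the edge set. -/
def dartEdge (d : G.Dart) : G.edgeSet := ⟨d.edge, d.edge_mem⟩

theorem dartEdge_eq_iff {d d' : G.Dart} : dartEdge d = dartEdge d' ↔ d = d' ∨ d = d'.symm := by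
  rw [dartEdge, dartEdge, Subtype.mk.injEq, SimpleGraph.dart_edge_eq_iff]

theorem dartEdge_surjective : Function.Surjective (dartEdge (G := G)) := by
  rintro ⟨e, he⟩
  induction e using Sym2.ind with
  | _ a b => exact ⟨⟨(a, b), he⟩, rfl⟩

theorem coboundary_dartEdge (x : V → ZMod 2) (d : G.Dart) :
    coboundary G x (dartEdge d) = x d.fst + x d.snd := rfl

theorem eq_of_coboundary_eq_zero (hG : G.Connected) {x : V → ZMod 2} (hx : coboundary G x = 0)
    (v w : V) : x v = x w := by
  obtain ⟨p⟩ := hG.preconnected v w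
  induction p with
  | nil => rfl
  | @cons a b _ hab _ ih =>
    have h := congrFun hx (dartEdge ⟨(a, b), hab⟩)
    rw [coboundary_dartEdge] at h
    exact (CharTwo.add_eq_zero.1 h).trans ih

section Matrix

variable [Fintype G.Dart] [DecidableEq R.Face] [DecidableEq G.edgeSet]

/-- The mod 2 incidence matrix of faces and edges. -/
def faceMatrix : Matrix R.Face G.edgeSet (ZMod 2) :=
  Matrix.of fun f e => ∑ d : G.Dart, if R.face d = f ∧ dartEdge d = e then 1 else 0

theorem faceMatrix_mulVec [Fintype G.edgeSet] (w : G.edgeSet → ZMod 2) (f : R.Face) :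
    (R.faceMatrix.mulVec w) f = ∑ d with R.face d = f, w (dartEdge d) := by
  simp only [faceMatrix, Matrix.mulVec, dotProduct, Matrix.of_apply, Finset.sum_mul]
  rw [Finset.sum_comm, Finset.sum_filter]
  refine Finset.sum_congr rfl fun d _ => ?_
  by_cases h : R.face d = f <;> simp [h]

/-- The transpose is the coboundary map of the dual graph, so connectedness of the dual bounds its
kernel. -/
theorem faceMatrix_transpose_mulVec [Fintype R.Face] (g : R.Face → ZMod 2) (d : G.Dart) :
    (R.faceMatrix.transpose.mulVec g) (dartEdge d) = g (R.face d) + g (R.face d.symm) := by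
  classical
  simp only [faceMatrix, Matrix.mulVec, dotProduct, Matrix.transpose_apply, Matrix.of_apply,
    Finset.sum_mul]
  rw [Finset.sum_comm]
  have h : ∀ d' : G.Dart, (∑ f, (if R.face d' = f ∧ dartEdge d' = dartEdge d then 1 else 0) * g f)
      = if d' ∈ ({d, d.symm} : Finset G.Dart) then g (R.face d') else 0 := by
    intro d'
    simp only [Finset.mem_insert, Finset.mem_singleton, ← dartEdge_eq_iff]
    by_cases h : dartEdge d' = dartEdge d <;> simp [h]
  rw [Finset.sum_congr rfl fun d' _ => h d', Finset.sum_ite_mem, Finset.univ_inter,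
    Finset.sum_pair d.symm_ne.symm]

/-- Each dart of a face ends where the next one starts, so the sums over targets and over sources
agree and cancel mod 2. -/
theorem faceMatrix_mulVec_coboundary [Fintype G.edgeSet] (x : V → ZMod 2) :
    R.faceMatrix.mulVec (coboundary G x) = 0 := by
  ext f
  rw [faceMatrix_mulVec]
  simp only [coboundary_dartEdge, Finset.sum_add_distrib, Pi.zero_apply]
  rw [CharTwo.add_eq_zero]
  refine (Finset.sum_equiv R.facePerm (fun d => ?_) fun d _ => ?_).symm
  · simp [face_facePerm]
  · rw [facePerm_fst]

end Matrix

/-- The first cohomology mod 2 of the sphere vanishes: an edge function whose sum along every face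
is zero is a coboundary. -/
theorem exists_coboundary_eq [Finite V] (hplane : R.IsPlane) [Fintype G.Dart]
    [DecidableEq R.Face] (w : G.edgeSet → ZMod 2)
    (hw : ∀ f, ∑ d with R.face d = f, w (dartEdge d) = 0) : ∃ x, coboundary G x = w := by
  classical
  obtain ⟨hG, hcard⟩ := hplane
  have := Fintype.ofFinite V
  have := Fintype.ofFinite R.Face
  have := Fintype.ofFinite G.edgeSet
  have : Nonempty V := hG.nonempty
  have hker : Module.finrank (ZMod 2) (LinearMap.ker (coboundary G)) ≤ 1 := by
    refine finrank_le_one ⟨fun _ => 1, ?_⟩ fun ⟨x, hx⟩ => ⟨x (Classical.arbitrary V), ?_⟩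
    · ext e
      obtain ⟨d, rfl⟩ := dartEdge_surjective e
      exact CharTwo.add_self_eq_zero (1 : ZMod 2)
    · ext v
      simpa using eq_of_coboundary_eq_zero hG hx _ v
  have hkerT : Module.finrank (ZMod 2) (LinearMap.ker R.faceMatrix.transpose.mulVecLin) ≤ 1 := by
    have hconst : ∀ g ∈ LinearMap.ker R.faceMatrix.transpose.mulVecLin, ∀ f f', g f = g f' := by
      intro g hg
      refine R.face_function_const hG g fun d => ?_
      have h := congrFun (LinearMap.mem_ker.1 hg) (dartEdge d)
      rw [Matrix.mulVecLin_apply, faceMatrix_transpose_mulVec] at h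
      exact CharTwo.add_eq_zero.1 h
    refine finrank_le_one ⟨fun _ => 1, ?_⟩ fun ⟨g, hg⟩ => ?_
    · ext e
      obtain ⟨d, rfl⟩ := dartEdge_surjective e
      rw [Matrix.mulVecLin_apply, faceMatrix_transpose_mulVec]
      exact CharTwo.add_self_eq_zero _
    · rcases isEmpty_or_nonempty R.Face with h | h
      · exact ⟨0, Subtype.ext (funext fun f => h.elim f)⟩
      · refine ⟨g (Classical.arbitrary _), ?_⟩
        ext f
        simpa using hconst g hg _ f
  have h₀ := (coboundary G).finrank_range_add_finrank_ker
  have h₁ := R.faceMatrix.mulVecLin.finrank_range_add_finrank_ker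
  have h₂ := R.faceMatrix.transpose.mulVecLin.finrank_range_add_finrank_ker
  have hrank : Module.finrank (ZMod 2) (LinearMap.range R.faceMatrix.transpose.mulVecLin) =
      Module.finrank (ZMod 2) (LinearMap.range R.faceMatrix.mulVecLin) :=
    R.faceMatrix.rank_transpose
  rw [Module.finrank_fintype_fun_eq_card] at h₀ h₁ h₂
  rw [Nat.card_eq_fintype_card, Nat.card_eq_fintype_card, Nat.card_eq_fintype_card] at hcard
  have hle : LinearMap.range (coboundary G) ≤ LinearMap.ker R.faceMatrix.mulVecLin := by
    rintro _ ⟨x, rfl⟩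
    exact R.faceMatrix_mulVec_coboundary x
  -- The range has dimension at least `|V| - 1`. The face matrix has rank at least `|F| - 1`, so its
  -- kernel has dimension at most `|E| - |F| + 1`, which is `|V| - 1` by Euler's formula.
  have heq := Submodule.eq_of_le_of_finrank_le hle (by omega)
  have hmem : w ∈ LinearMap.ker R.faceMatrix.mulVecLin := by
    rw [LinearMap.mem_ker, Matrix.mulVecLin_apply]
    ext f
    rw [faceMatrix_mulVec, hw, Pi.zero_apply]
  rw [← heq] at hmem
  exact hmem

end Cohomology

/-! ### Fisher cities, perfect matchings and spins. -/

section Triangles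

variable {V : Type*} {G : SimpleGraph V} {R : RotationSystem G}

theorem IsTriangulated.minimalPeriod_facePerm [Finite V] (htri : R.IsTriangulated) (d : G.Dart) :
    Function.minimalPeriod R.facePerm d = 3 := by
  classical
  have hset : {d' | R.face d' = R.face d} =
      (((Finset.range (Function.minimalPeriod R.facePerm d)).image
        fun n => R.facePerm^[n] d : Finset G.Dart) : Set G.Dart) := by
    ext d'
    have hper : 0 < Function.minimalPeriod R.facePerm d :=
      Function.minimalPeriod_pos_of_mem_periodicPts
        (R.facePerm.injective.mem_periodicPts d)
    simp only [Set.mem_ofPred_eq, Finset.coe_image, Finset.coe_range, Set.mem_image, Set.mem_Iio]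
    constructor
    · intro h
      obtain ⟨n, hn⟩ := ((R.face_eq_face_iff.1 h.symm).exists_nat_pow_eq)
      refine ⟨n % Function.minimalPeriod R.facePerm d, Nat.mod_lt _ hper, ?_⟩
      rw [Function.iterate_mod_minimalPeriod_eq, ← hn, Equiv.Perm.iterate_eq_pow]
    · rintro ⟨n, -, rfl⟩
      rw [Equiv.Perm.iterate_eq_pow]
      exact R.face_eq_face_iff.2 (Equiv.Perm.sameCycle_pow_left.2 (Equiv.Perm.SameCycle.refl _ _))
  have h := htri (R.face d)
  rw [hset, Set.ncard_coe_finset, Finset.card_image_of_injOn, Finset.card_range] at h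
  · exact h
  · intro i hi j hj hij
    exact Function.iterate_injOn_Iio_minimalPeriod (by simpa using hi) (by simpa using hj) hij

theorem IsTriangulated.facePerm_three [Finite V] (htri : R.IsTriangulated) (d : G.Dart) :
    R.facePerm (R.facePerm (R.facePerm d)) = d := by
  have h := Function.iterate_minimalPeriod (f := R.facePerm) (x := d)
  rwa [htri.minimalPeriod_facePerm] at h

theorem facePerm_ne (d : G.Dart) : R.facePerm d ≠ d := by
  intro h
  exact d.fst_ne_snd ((congrArg (fun e : G.Dart => e.fst) h).symm.trans (R.facePerm_fst d))

theorem IsTriangulated.facePerm_two_ne [Finite V] (htri : R.IsTriangulated) (d : G.Dart) :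
    R.facePerm (R.facePerm d) ≠ d := by
  intro h
  exact facePerm_ne d ((congrArg R.facePerm h).symm.trans (htri.facePerm_three d))

theorem IsTriangulated.face_eq_iff [Finite V] (htri : R.IsTriangulated) {d d' : G.Dart} :
    R.face d' = R.face d ↔
      d' = d ∨ d' = R.facePerm d ∨ d' = R.facePerm (R.facePerm d) := by
  constructor
  · intro h
    obtain ⟨n, rfl⟩ := (R.face_eq_face_iff.1 h.symm).exists_nat_pow_eq
    rw [← Equiv.Perm.iterate_eq_pow, ← Function.iterate_mod_minimalPeriod_eq,
      htri.minimalPeriod_facePerm]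
    have : n % 3 < 3 := Nat.mod_lt _ (by norm_num)
    interval_cases n % 3 <;> simp
  · rintro (rfl | rfl | rfl) <;> simp only [face_facePerm]

/-- If both sides of an edge lay on one triangle, another dart of that triangle would be a loop.
Hence no edge of `G*` is both an intercity and a city edge. -/
theorem IsTriangulated.face_symm_ne [Finite V] (htri : R.IsTriangulated) (d : G.Dart) :
    R.face d.symm ≠ R.face d := by
  intro h
  have h₁ := R.facePerm_fst d
  have h₂ := R.facePerm_fst (R.facePerm d)
  have h₃ := R.facePerm_fst (R.facePerm (R.facePerm d))
  rw [htri.facePerm_three] at h₃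
  rcases htri.face_eq_iff.1 h with h | h | h
  · exact d.symm_ne h
  · rw [← h] at h₂ h₃
    exact (R.facePerm d.symm).fst_ne_snd (h₂.trans h₃)
  · rw [← h] at h₂
    exact (R.facePerm d).fst_ne_snd (h₁.trans h₂)

/-- A set of darts meets each face (a triangle) in an odd number of darts, i.e. the complement of
the set meets it in no dart or in two. -/
def FaceOdd (R : RotationSystem G) (P : G.Dart → Prop) : Prop :=
  ∀ d, ¬ P d → (P (R.facePerm d) ↔ ¬ P (R.facePerm (R.facePerm d)))

theorem IsTriangulated.faceOdd_spin [Finite V] (htri : R.IsTriangulated) (X : V → ℤˣ) :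
    R.FaceOdd fun d => X d.fst = X d.snd := by
  intro d
  have h₃ := R.facePerm_fst (R.facePerm (R.facePerm d))
  rw [htri.facePerm_three] at h₃
  simp only [← h₃, R.facePerm_fst (R.facePerm d), R.facePerm_fst d]
  rcases Int.units_eq_one_or (X d.fst) with h | h <;>
  rcases Int.units_eq_one_or (X d.snd) with h' | h' <;>
  rcases Int.units_eq_one_or (X (R.facePerm d).snd) with h'' | h'' <;>
  simp [h, h', h'']

/-- A perfect matching of `G*` has an odd number of intercity edges at every face. -/
theorem IsTriangulated.faceOdd_of_isPerfectMatching [Finite V] (htri : R.IsTriangulated)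
    {S : R.expandedDual.Subgraph} (hS : S.IsPerfectMatching) :
    R.FaceOdd fun d => S.Adj d d.symm := by
  have hex := fun d => (SimpleGraph.Subgraph.isPerfectMatching_iff.1 hS d).exists
  have huniq : ∀ {d a b}, S.Adj d a → S.Adj d b → a = b := fun {d _ _} ha hb =>
    (SimpleGraph.Subgraph.isPerfectMatching_iff.1 hS d).unique ha hb
  have hcity : ∀ d, ¬ S.Adj d d.symm →
      S.Adj d (R.facePerm d) ∨ S.Adj d (R.facePerm (R.facePerm d)) := by
    intro d hd
    obtain ⟨d', h⟩ := hex d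
    obtain ⟨hne, hface | rfl⟩ := S.adj_sub h
    · rcases htri.face_eq_iff.1 hface.symm with rfl | rfl | rfl
      · exact (hne rfl).elim
      · exact Or.inl h
      · exact Or.inr h
    · exact (hd h).elim
  have hnot : ∀ {d d'}, R.face d' = R.face d → S.Adj d d' → ¬ S.Adj d d.symm :=
    fun {d d'} hf h h' => htri.face_symm_ne d (huniq h h' ▸ hf)
  have h12 : ∀ d, R.facePerm (R.facePerm d) ≠ R.facePerm d := fun d => facePerm_ne _
  intro d hd
  simp only
  rcases hcity d hd with h | h
  · refine iff_of_false (hnot (R.face_facePerm d).symm h.symm) (not_not.2 ?_)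
    -- The third dart of the city would need a partner in it, but the other two are matched to each
    -- other.
    by_contra h2
    rcases hcity _ h2 with h' | h'
    · rw [htri.facePerm_three] at h'
      exact h12 d (huniq h'.symm h)
    · rw [htri.facePerm_three] at h'
      exact htri.facePerm_two_ne d (huniq h'.symm h.symm)
  · refine iff_of_true ?_ (hnot (by simp only [face_facePerm]) h.symm)
    by_contra h2
    rcases hcity _ h2 with h' | h'
    · exact facePerm_ne d (huniq h'.symm h.symm)
    · rw [htri.facePerm_three] at h'
      exact h12 d (huniq h h'.symm)

/-- The matching of `G*` that uses the intercity edges at the darts in `P` and joins the other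
darts within their faces. -/
def matchingOf (R : RotationSystem G) (P : G.Dart → Prop) (hsymm : ∀ d, P d → P d.symm) :
    R.expandedDual.Subgraph where
  verts := Set.univ
  Adj d d' := (P d ∧ d' = d.symm) ∨ (¬ P d ∧ ¬ P d' ∧ d ≠ d' ∧ R.face d = R.face d')
  adj_sub := by
    rintro d _ (⟨-, rfl⟩ | ⟨-, -, h, h'⟩)
    · exact ⟨d.symm_ne.symm, Or.inr rfl⟩
    · exact ⟨h, Or.inl h'⟩
  edge_vert _ := Set.mem_univ _
  symm := ⟨by
    rintro d _ (⟨h, rfl⟩ | ⟨h₁, h₂, h₃, h₄⟩)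
    · exact Or.inl ⟨hsymm d h, d.symm_symm.symm⟩
    · exact Or.inr ⟨h₂, h₁, h₃.symm, h₄.symm⟩⟩

theorem IsTriangulated.isPerfectMatching_matchingOf [Finite V] (htri : R.IsTriangulated)
    {P : G.Dart → Prop} (hsymm : ∀ d, P d → P d.symm) (hP : R.FaceOdd P) :
    (R.matchingOf P hsymm).IsPerfectMatching := by
  rw [SimpleGraph.Subgraph.isPerfectMatching_iff]
  intro d
  by_cases hd : P d
  · refine ⟨d.symm, Or.inl ⟨hd, rfl⟩, ?_⟩
    rintro d' (⟨-, h⟩ | ⟨h, -⟩)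
    · exact h
    · exact (h hd).elim
  · by_cases h1 : P (R.facePerm d)
    · have h2 := (hP d hd).1 h1
      refine ⟨R.facePerm (R.facePerm d), Or.inr ⟨hd, h2, (htri.facePerm_two_ne d).symm, by
        simp only [face_facePerm]⟩, ?_⟩
      rintro d' (⟨h, -⟩ | ⟨-, h, hne, hf⟩)
      · exact (hd h).elim
      · rcases htri.face_eq_iff.1 hf.symm with rfl | rfl | rfl
        · exact (hne rfl).elim
        · exact (h h1).elim
        · rfl
    · have h2 : P (R.facePerm (R.facePerm d)) := by
        by_contra h2
        exact h1 ((hP d hd).2 h2)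
      refine ⟨R.facePerm d, Or.inr ⟨hd, h1, (facePerm_ne d).symm, by
        simp only [face_facePerm]⟩, ?_⟩
      rintro d' (⟨h, -⟩ | ⟨-, h, hne, hf⟩)
      · exact (hd h).elim
      · rcases htri.face_eq_iff.1 hf.symm with rfl | rfl | rfl
        · exact (hne rfl).elim
        · rfl
        · exact (h h2).elim

theorem IsTriangulated.matchingOf_adj_symm [Finite V] (htri : R.IsTriangulated)
    {P : G.Dart → Prop} (hsymm : ∀ d, P d → P d.symm) (d : G.Dart) :
    (R.matchingOf P hsymm).Adj d d.symm ↔ P d := by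
  refine ⟨?_, fun h => Or.inl ⟨h, rfl⟩⟩
  rintro (⟨h, -⟩ | ⟨-, -, -, h⟩)
  · exact h
  · exact (htri.face_symm_ne d h.symm).elim

/-- Perfect matchings of `G*` with the same intercity edges are equal. -/
theorem IsTriangulated.perfectMatching_ext [Finite V] (htri : R.IsTriangulated)
    {S T : R.expandedDual.Subgraph} (hS : S.IsPerfectMatching) (hT : T.IsPerfectMatching)
    (h : ∀ d : G.Dart, S.Adj d d.symm ↔ T.Adj d d.symm) : S = T := by
  have key : ∀ {S : R.expandedDual.Subgraph} (_ : S.IsPerfectMatching),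
      S = R.matchingOf (fun d => S.Adj d d.symm)
        (fun d hd => by simpa using hd.symm) := by
    intro S hS
    set T := R.matchingOf (fun d => S.Adj d d.symm) (fun d hd => by simpa using hd.symm) with hTdef
    have hT : T.IsPerfectMatching :=
      htri.isPerfectMatching_matchingOf _ (htri.faceOdd_of_isPerfectMatching hS)
    have hST : ∀ {d d'}, S.Adj d d' → T.Adj d d' := by
      have huniq : ∀ {d a b}, S.Adj d a → S.Adj d b → a = b := fun {d _ _} ha hb =>
        (SimpleGraph.Subgraph.isPerfectMatching_iff.1 hS d).unique ha hb
      intro d d' hdd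
      obtain ⟨hne, hf | rfl⟩ := S.adj_sub hdd
      · exact Or.inr ⟨fun h' => htri.face_symm_ne d (huniq hdd h' ▸ hf.symm),
          fun h' => htri.face_symm_ne d' (huniq hdd.symm h' ▸ hf), hne, hf⟩
      · exact Or.inl ⟨hdd, rfl⟩
    refine SimpleGraph.Subgraph.ext ?_ ?_
    · exact Set.eq_univ_of_forall hS.2
    · ext d d'
      -- Inclusion between perfect matchings is equality: the partner in `S` is also the only
      -- partner in `T`.
      refine ⟨hST, fun hdd => ?_⟩
      obtain ⟨b, hb⟩ := (SimpleGraph.Subgraph.isPerfectMatching_iff.1 hS d).exists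
      rwa [(SimpleGraph.Subgraph.isPerfectMatching_iff.1 hT d).unique hdd (hST hb)]
  rw [key hS, key hT]
  congr 1
  exact funext fun d => propext (h d)

theorem mem_saturated_iff {X : V → ℤˣ} {d : G.Dart} :
    s(d, d.symm) ∈ R.saturated X ↔ X d.fst = X d.snd := by
  refine ⟨?_, fun h => ⟨d, rfl, h⟩⟩
  rintro ⟨d', h, hX⟩
  rcases Sym2.eq_iff.1 h with ⟨rfl, -⟩ | ⟨rfl, -⟩
  · exact hX
  · exact hX.symm

theorem edgeSet_inter_intercityEdges_eq_iff {S : R.expandedDual.Subgraph} {X : V → ℤˣ} :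
    S.edgeSet ∩ R.intercityEdges = R.saturated X ↔
      ∀ d : G.Dart, S.Adj d d.symm ↔ X d.fst = X d.snd := by
  constructor
  · intro h d
    rw [← mem_saturated_iff (R := R), ← h]
    exact ⟨fun hd => ⟨hd, d, rfl⟩, fun hd => hd.1⟩
  · intro h
    ext e
    constructor
    · rintro ⟨he, d, rfl⟩
      exact ⟨d, rfl, (h d).1 he⟩
    · rintro ⟨d, rfl, hX⟩
      exact ⟨(h d).2 hX, d, rfl⟩

theorem IsTriangulated.existsUnique_completes [Finite V] (htri : R.IsTriangulated) (X : V → ℤˣ) :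
    ∃! S : R.expandedDual.Subgraph, R.Completes X S := by
  have hsymm : ∀ d : G.Dart, X d.fst = X d.snd → X d.symm.fst = X d.symm.snd := fun _ h => h.symm
  refine ⟨R.matchingOf (fun d => X d.fst = X d.snd) hsymm,
    ⟨htri.isPerfectMatching_matchingOf hsymm (htri.faceOdd_spin X),
      edgeSet_inter_intercityEdges_eq_iff.2 (htri.matchingOf_adj_symm hsymm)⟩, ?_⟩
  rintro S ⟨hS, hSX⟩
  refine htri.perfectMatching_ext hS
    (htri.isPerfectMatching_matchingOf hsymm (htri.faceOdd_spin X)) fun d => ?_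
  rw [edgeSet_inter_intercityEdges_eq_iff.1 hSX, htri.matchingOf_adj_symm]

/-- With only two spin values, the spin at one end of an edge and whether the ends agree determine
the other, so equality spreads along walks. -/
theorem spin_eq_of_connected (hG : G.Connected) {X Y : V → ℤˣ}
    (h : ∀ d : G.Dart, X d.fst = X d.snd ↔ Y d.fst = Y d.snd) {v : V} (hv : X v = Y v) :
    X = Y := by
  funext w
  obtain ⟨p⟩ := hG.preconnected v w
  induction p with
  | nil => exact hv
  | @cons a b _ hab _ ih =>
    refine ih ?_
    have h' : X a = X b ↔ Y a = Y b := h ⟨(a, b), hab⟩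
    rcases Int.units_eq_one_or (X a) with ha | ha <;>
    rcases Int.units_eq_one_or (X b) with hb | hb <;>
    rcases Int.units_eq_one_or (Y b) with hc | hc <;>
    simp_all

/-- A symmetric set of darts meeting every face in an odd number of darts is the set of darts along
which some spin configuration is constant. -/
theorem exists_spin_of_faceOdd [Finite V] (hplane : R.IsPlane) (htri : R.IsTriangulated)
    {P : G.Dart → Prop} (hsymm : ∀ d, P d.symm ↔ P d) (hP : R.FaceOdd P) (v : V) :
    ∃ X : V → ℤˣ, X v = 1 ∧ ∀ d : G.Dart, P d ↔ X d.fst = X d.snd := by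
  classical
  have := Fintype.ofFinite G.Dart
  -- Edges outside `P` get weight 1; oddness of `P` leaves zero or two of them on each triangle.
  let w : G.edgeSet → ZMod 2 := fun e => if ∃ d, dartEdge d = e ∧ P d then 0 else 1
  have hw : ∀ d, w (dartEdge d) = if P d then 0 else 1 := by
    intro d
    have : (∃ d', dartEdge d' = dartEdge d ∧ P d') ↔ P d := by
      refine ⟨?_, fun h => ⟨d, rfl, h⟩⟩
      rintro ⟨d', h, h'⟩
      rcases dartEdge_eq_iff.1 h with rfl | rfl
      · exact h'
      · exact (hsymm d).1 h'
    simp only [w, this]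
  obtain ⟨x, hx⟩ := R.exists_coboundary_eq hplane w (by
    intro f
    obtain ⟨d, rfl⟩ := R.face_surjective f
    have hset : (Finset.univ.filter fun d' => R.face d' = R.face d) =
        {d, R.facePerm d, R.facePerm (R.facePerm d)} := by
      ext d'
      simp [htri.face_eq_iff]
    rw [hset, Finset.sum_insert, Finset.sum_pair (facePerm_ne _).symm, hw, hw, hw]
    · have h₀ := hP d
      have h₁ := hP (R.facePerm d)
      have h₂ := hP (R.facePerm (R.facePerm d))
      simp only [htri.facePerm_three] at h₁ h₂
      by_cases a : P d <;> by_cases b : P (R.facePerm d) <;>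
        by_cases c : P (R.facePerm (R.facePerm d)) <;> simp_all [CharTwo.add_self_eq_zero]
    · simp only [Finset.mem_insert, Finset.mem_singleton, not_or]
      exact ⟨(facePerm_ne d).symm, (htri.facePerm_two_ne d).symm⟩)
  -- Measuring `x` relative to its value at `v` forces spin `+1` there.
  refine ⟨fun u => if x u = x v then 1 else -1, by simp, fun d => ?_⟩
  have h := hw d
  rw [← hx, coboundary_dartEdge] at h
  have hPx : P d ↔ x d.fst = x d.snd := by
    rw [← CharTwo.add_eq_zero, h]
    by_cases hd : P d <;> simp [hd]
  rw [hPx]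
  have hdec : ∀ a b c : ZMod 2, a = b ↔
      (if a = c then (1 : ℤˣ) else -1) = if b = c then 1 else -1 := by decide
  exact hdec _ _ _

end Triangles

end RotationSystem

theorem mainTheorem9 {V : Type*} [Finite V] (G : SimpleGraph V) (R : RotationSystem G)
    (hplane : R.IsPlane) (htri : R.IsTriangulated) (v₁ : V) :
    (∀ X : V → ℤˣ, ∃! S : R.expandedDual.Subgraph, R.Completes X S) ∧
    (∀ X : V → ℤˣ, R.Completes X (R.matching X)) ∧
    Set.BijOn R.matching {X : V → ℤˣ | X v₁ = 1}
      {S : R.expandedDual.Subgraph | S.IsPerfectMatching} := by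
  have hM : ∀ X : V → ℤˣ, R.Completes X (R.matching X) := fun X =>
    Classical.epsilon_spec (htri.existsUnique_completes X).exists
  refine ⟨htri.existsUnique_completes, hM, fun X _ => (hM X).1, ?_, ?_⟩
  · intro X hX Y hY hXY
    refine RotationSystem.spin_eq_of_connected hplane.1 (fun d => ?_)
      (hX.trans (Eq.symm hY) : X v₁ = Y v₁)
    rw [← RotationSystem.edgeSet_inter_intercityEdges_eq_iff.1 (hM X).2 d, hXY,
      RotationSystem.edgeSet_inter_intercityEdges_eq_iff.1 (hM Y).2 d]
  · intro S hS
    obtain ⟨X, hX, hSX⟩ := RotationSystem.exists_spin_of_faceOdd hplane htri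
      (P := fun d => S.Adj d d.symm)
      (fun d => by rw [SimpleGraph.Dart.symm_symm]; exact S.adj_comm _ _)
      (htri.faceOdd_of_isPerfectMatching hS) v₁
    exact ⟨X, hX, (htri.existsUnique_completes X).unique (hM X)
      ⟨hS, RotationSystem.edgeSet_inter_intercityEdges_eq_iff.2 hSX⟩⟩
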